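/- **Existence of Bayesian equilibria.** Consider a game with finitely many players $i=1,\dots,n$, a measurable space $(S,\mathcal S)$ of payoff states, measurable type spaces $(T_i,\mathcal T_i)$, and action spaces $A_i$. Write $T=\prod_i T_i$, $A=\prod_i A_i$, $T_{-i}=\prod_{j\ne i}T_j$, with product $\sigma$-algebras. Player $i$ has a payoff function $u_i:A\times S\times T\to\mathbb R$ that is $\mathcal B(A)\otimes\mathcal S\otimes\mathcal T$-measurable, and a belief map $\eta_i$, a probability kernel from $T_i$ to $S\times T_{-i}$. A behavioral strategy of player $i$ is a probability kernel $\gamma_i$ from $T_i$ to $(A_i,\mathcal B(A_i))$; let $\mathcal R_i$ be the set of these and $\mathcal R=\prod_i\mathcal R_i$. For $\gamma\in\mathcal R$ and $t_i\in T_i$ put $$U_i(\gamma;t_i)=\int\Big(\int_A u_i(a,s,t)\,\textstyle\bigotimes_{j}\gamma_j(t_j,\cdot)(da)\Big)\,\eta_i(t_i,d(s,t_{-i})).$$ A profile $\gamma^*\in\mathcal R$ is a *Bayesian equilibrium* if $U_i(\gamma_i^*,\gamma_{-i}^*;t_i)\ge U_i(\gamma_i,\gamma_{-i}^*;t_i)$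 for every $i$, **every** $t_i\in T_i$ and every $\gamma_i\in\mathcal R_i$. Assume that, for each $i$: 1. $\mathcal T_i$ is universally complete (it contains every set that belongs to the $\mu$-completion of $\mathcal T_i$ for all probability measures $\mu$ on $\mathcal T_i$), and $A_i$ is a compact metrizable space; 2. $\overline u_i:T_i\to[0,\infty)$ is a $\mathcal T_i$-measurable map with $|u_i(a,s,t)|\le\overline u_i(t_i)$ for all $a\in A$, $s\in S$, $t\in T$; 3. for all $a_{-i}$, $s$, $t$, the map $a_i\mapsto u_i(a_i,a_{-i},s,t)$ is upper semicontinuous on $A_i$. Let $\mathcal M$ be the set of product probability measures $\nu=\nu_0\otimes\nu_1\otimes\dots\otimes\nu_n$ on $S\times T$ such that $\eta_i(t_i,\cdot)\ll\nu_0\otimes\bigotimes_{j\ne i}\nu_j$ for every $i$ and every $t_i\in T_i$, and $\int\overline u_i\,d\nu_i<\infty$ for every $i$. Suppose $\mathcal M\neq\varnothing$. For $\nu\in\mathcal M$ let $G^*(\nu)$ be the complete-information game in which player $i$ chooses $\gamma_i\in\mathcal R_i$ and receives $\int U_i(\gamma;t_i)\,\nu_i(dt_i)$. Then a Bayesian equilibrium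 exists if and only if $G^*(\nu)$ has a Nash equilibrium for some $\nu\in\mathcal M$. Moreover, for every $\nu\in\mathcal M$ and every Nash equilibrium $\widetilde\gamma$ of $G^*(\nu)$ there is a Bayesian equilibrium $\gamma$ such that, for each $i$, $\gamma_i(t_i,\cdot)=\widetilde\gamma_i(t_i,\cdot)$ for $\nu_i$-almost every $t_i$. -/

import Mathlib

open MeasureTheory ProbabilityTheory
open scoped NNReal ENNReal

/-- A σ-algebra is universally complete if it coincides with its universal completion, i.e. it
contains every set that belongs to the `μ`-completion of the σ-algebra for every probability
measure `μ`. (`NullMeasurableSet E μ` says that `E` belongs to the `μ`-completion.) -/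
def UniversallyComplete (X : Type*) [MeasurableSpace X] : Prop :=
  ∀ E : Set X, (∀ μ : Measure X, IsProbabilityMeasure μ → NullMeasurableSet E μ) →
    MeasurableSet E

/-- An incomplete information game with player set `ι`, payoff states `S`, type spaces `T i` and
action spaces `A i`: jointly measurable payoff functions `u i (a, s, t)`, and belief maps, which
are probability kernels from `T i` to `S × ∏_{j ≠ i} T j`. -/
structure IncompleteInfoGame (ι : Type*) (S : Type*) (T : ι → Type*) (A : ι → Type*)
    [MeasurableSpace S] [∀ i, MeasurableSpace (T i)] [∀ i, MeasurableSpace (A i)] where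
  payoff : ι → (∀ j, A j) → S → (∀ j, T j) → ℝ
  measurable_payoff : ∀ i, Measurable
    (fun p : (∀ j, A j) × S × (∀ j, T j) => payoff i p.1 p.2.1 p.2.2)
  belief : ∀ i, Kernel (T i) (S × (∀ j : {j // j ≠ i}, T j))
  isMarkovKernel_belief : ∀ i, IsMarkovKernel (belief i)

/-- A behavioral strategy: a probability kernel from types to actions. -/
def BehavioralStrategy (X Y : Type*) [MeasurableSpace X] [MeasurableSpace Y] : Type _ :=
  {κ : Kernel X Y // IsMarkovKernel κ}

/-- A product probability measure `ν₀ ⊗ ⨂ᵢ νᵢ` on `S × ∏ᵢ T i`, recorded by its factors. (The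
factors are the marginals of the product, so they are determined by it.) -/
structure ProductProbability {ι : Type*} (S : Type*) (T : ι → Type*)
    [MeasurableSpace S] [∀ i, MeasurableSpace (T i)] where
  state : ProbabilityMeasure S
  type : ∀ i, ProbabilityMeasure (T i)

namespace ProductProbability

variable {ι : Type*} [Fintype ι] {S : Type*} {T : ι → Type*}
  [MeasurableSpace S] [∀ i, MeasurableSpace (T i)]

/-- The product measure `ν₀ ⊗ ν₋ᵢ` on `S × ∏_{j ≠ i} T j`. -/
noncomputable def others [DecidableEq ι] (ν : ProductProbability S T) (i : ι) :
    Measure (S × (∀ j : {j // j ≠ i}, T j)) :=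
  (ν.state : Measure S).prod
    (Measure.pi fun j : {j // j ≠ i} => (ν.type j : Measure (T j)))

end ProductProbability

namespace IncompleteInfoGame

variable {ι : Type*} [Fintype ι] [DecidableEq ι] {S : Type*} {T : ι → Type*} {A : ι → Type*}
  [MeasurableSpace S] [∀ i, MeasurableSpace (T i)] [∀ i, MeasurableSpace (A i)]

/-- `V_i(γ; s, t)`: the payoff of player `i` at `(s, t)` when the actions are drawn independently
from `γ_1(t_1, ·), …, γ_n(t_n, ·)`. -/
noncomputable def stateTypePayoff (G : IncompleteInfoGame ι S T A) (i : ι)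
    (γ : ∀ j, BehavioralStrategy (T j) (A j)) (s : S) (t : ∀ j, T j) : ℝ :=
  ∫ a, G.payoff i a s t ∂(Measure.pi fun j => (γ j).1 (t j))

/-- `U_i(γ; t_i)`: the expected payoff of type `ti` of player `i` under the belief
`η_i(t_i, ·)`. Here `(Equiv.piSplitAt i T).symm (ti, t₋ᵢ)` is the type profile with `i`-th
coordinate `ti` and remaining coordinates `t₋ᵢ`. -/
noncomputable def expectedPayoff (G : IncompleteInfoGame ι S T A) (i : ι)
    (γ : ∀ j, BehavioralStrategy (T j) (A j)) (ti : T i) : ℝ :=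
  ∫ p, G.stateTypePayoff i γ p.1 ((Equiv.piSplitAt i T).symm (ti, p.2)) ∂(G.belief i ti)

/-- The set `BE` of Bayesian equilibria: no type of any player gains by deviating. -/
def bayesianEquilibria (G : IncompleteInfoGame ι S T A) :
    Set (∀ j, BehavioralStrategy (T j) (A j)) :=
  {γ | ∀ (i : ι) (ti : T i) (γi : BehavioralStrategy (T i) (A i)),
    G.expectedPayoff i (Function.update γ i γi) ti ≤ G.expectedPayoff i γ ti}

/-- `ubar` is a measurable family of type-dependent bounds: `|u_i(a, s, t)| ≤ ubar_i(t_i)`. -/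
def IsPayoffBound (G : IncompleteInfoGame ι S T A) (ubar : ∀ i, T i → ℝ≥0) : Prop :=
  (∀ i, Measurable (ubar i)) ∧ ∀ i a s t, |G.payoff i a s t| ≤ ubar i (t i)

/-- Each payoff function is upper semicontinuous in the player's own action. -/
def UpperSemicontinuousInOwnAction [∀ i, TopologicalSpace (A i)]
    (G : IncompleteInfoGame ι S T A) : Prop :=
  ∀ (i : ι) (a : ∀ j, A j) (s : S) (t : ∀ j, T j),
    UpperSemicontinuous fun ai : A i => G.payoff i (Function.update a i ai) s t

/-- The set `M` of product probability measures `ν` which dominate the belief maps,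
`η_i(t_i, ·) ≪ ν₀ ⊗ ν₋ᵢ` for every `i` and every `t_i`, and integrate the bounds `ubar_i`. -/
def dominatingMeasures (G : IncompleteInfoGame ι S T A) (ubar : ∀ i, T i → ℝ≥0) :
    Set (ProductProbability S T) :=
  {ν | (∀ (i : ι) (ti : T i), G.belief i ti ≪ ν.others i) ∧
    ∀ i, ∫⁻ ti, (ubar i ti : ℝ≥0∞) ∂(ν.type i : Measure (T i)) < ∞}

/-- The payoff of player `i` in the surrogate complete information game `G*(ν)`, in which the
players choose behavioral strategies. -/
noncomputable def surrogatePayoff (G : IncompleteInfoGame ι S T A) (ν : ProductProbability S T)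
    (i : ι) (γ : ∀ j, BehavioralStrategy (T j) (A j)) : ℝ :=
  ∫ ti, G.expectedPayoff i γ ti ∂(ν.type i : Measure (T i))

/-- The set `NE_ν` of Nash equilibria of the surrogate game `G*(ν)`. -/
def nashEquilibria (G : IncompleteInfoGame ι S T A) (ν : ProductProbability S T) :
    Set (∀ j, BehavioralStrategy (T j) (A j)) :=
  {γ | ∀ (i : ι) (γi : BehavioralStrategy (T i) (A i)),
    G.surrogatePayoff ν i (Function.update γ i γi) ≤ G.surrogatePayoff ν i γ}

end IncompleteInfoGame

/-! A Bayesian equilibrium is a Nash equilibrium of every `G*(ν)`: integrate the inequalities over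
types. Conversely, a Nash equilibrium `γ'` can only fail to be optimal on null sets of types, and it
is repaired there.

By Fubini, the payoff of a type is linear in its own mixed action: it is the integral of
`actionPayoff`, which is jointly measurable and upper semicontinuous in the action. A measurable
selection `g i` of maximizing actions therefore exists, and `γ i` plays `g i` at the types where `γ'
i` is suboptimal. This deviation loses for no type, so the Nash inequality forces its gain to vanish
`ν_i`-almost everywhere; hence `γ i = γ' i` almost everywhere. As every belief is dominated by `ν₀ ⊗
ν₋ᵢ`, no type of any player notices that the opponents changed on null sets
(`expectedPayoff_update_congr`), so optimality against `γ'` is optimality against `γ`.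

The selection (`UniversallyComplete.exists_measurable_isMax`) rests on the measurable projection
theorem, and that on the universal measurability of analytic sets, proved by inner approximation
with compact sets. -/

/-! ### Analytic sets are universally measurable. -/

theorem isCompact_setOf_forall_le (b : ℕ → ℕ) : IsCompact {x : ℕ → ℕ | ∀ i, x i ≤ b i} := by
  have : {x : ℕ → ℕ | ∀ i, x i ≤ b i} = Set.univ.pi fun i => Set.Iic (b i) := by
    ext
    simp [Pi.le_def]
  rw [this]
  exact isCompact_univ_pi fun i => (Set.finite_Iic (b i)).isCompact

/-- A neighbourhood of the compact box `{x | x ≤ b}` contains a box that is bounded in finitely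
many coordinates only. -/
theorem exists_finite_box_subset {U : Set (ℕ → ℕ)} (hU : IsOpen U) (b : ℕ → ℕ)
    (hb : {x | ∀ i, x i ≤ b i} ⊆ U) : ∃ k, {x : ℕ → ℕ | ∀ i < k, x i ≤ b i} ⊆ U := by
  by_contra! h
  choose x hx hxU using fun k => Set.not_subset.1 (h k)
  have hK := isCompact_setOf_forall_le b
  -- Truncation by `b` puts the sequence in the compact box. It leaves coordinate `i` of `x k`
  -- unchanged once `k > i`, so `x` has the same subsequential limit.
  obtain ⟨y, hy, φ, hφ, hlim⟩ := hK.tendsto_subseq (x := fun k i => min (x k i) (b i))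
    (fun k i => min_le_right _ _)
  have hlim' : Filter.Tendsto (fun n => x (φ n)) Filter.atTop (nhds y) := by
    rw [tendsto_pi_nhds] at hlim ⊢
    intro i
    refine (hlim i).congr' ?_
    filter_upwards [Filter.eventually_gt_atTop i] with n hn
    exact min_eq_left (hx (φ n) i (hn.trans_le (hφ.id_le n)))
  obtain ⟨n, hn⟩ := (hlim'.eventually (hU.mem_nhds (hb hy))).exists
  exact hxU _ hn

/-- Inner regularity of finite measures on analytic sets (a case of Choquet's capacitability
theorem). -/
theorem MeasureTheory.exists_isCompact_subset_range_le_measure {X : Type*} [TopologicalSpace X]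
    [T2Space X] [MeasurableSpace X] [OpensMeasurableSpace X] (μ : Measure X) [IsFiniteMeasure μ]
    {f : (ℕ → ℕ) → X} (hf : Continuous f) {c : ℝ≥0∞} (hc : c < μ (Set.range f)) :
    ∃ K ⊆ Set.range f, IsCompact K ∧ c ≤ μ K := by
  let N : (ℕ → ℕ) → ℕ → Set (ℕ → ℕ) := fun b k => {x | ∀ i < k, x i ≤ b i}
  -- These images need not be measurable, but continuity from below along increasing sequences holds
  -- for arbitrary sets. Iterating over `k` bounds one coordinate at a time.
  have step : ∀ (k : ℕ) (B : Set (ℕ → ℕ)), c < μ (f '' B) →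
      ∃ m : ℕ, c < μ (f '' (B ∩ {x | x k ≤ m})) := by
    intro k B hB
    have hmono : Monotone fun m : ℕ => f '' (B ∩ {x | x k ≤ m}) := fun m m' h =>
      Set.image_mono (Set.inter_subset_inter_right _ fun x (hx : x k ≤ m) => hx.trans h)
    have hun : f '' B = ⋃ m : ℕ, f '' (B ∩ {x | x k ≤ m}) := by
      rw [← Set.image_iUnion, ← Set.inter_iUnion]
      congr 1
      ext x
      simpa using fun _ => ⟨x k, le_rfl⟩
    rw [hun, hmono.measure_iUnion] at hB
    exact lt_iSup_iff.1 hB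
  choose! m hm using step
  let B : ℕ → Set (ℕ → ℕ) := fun n => Nat.rec Set.univ (fun k B => B ∩ {x | x k ≤ m k B}) n
  have hBc : ∀ k, c < μ (f '' B k) := by
    intro k
    induction k with
    | zero => simpa [B] using hc
    | succ k ih => exact hm k _ ih
  let b : ℕ → ℕ := fun k => m k (B k)
  have hBN : ∀ k, B k = N b k := by
    intro k
    induction k with
    | zero => ext; simp [B, N]
    | succ k ih =>
      have : B (k + 1) = B k ∩ {x | x k ≤ b k} := rfl
      rw [this, ih]
      ext x
      exact Nat.forall_lt_succ_right.symm
  have hK := isCompact_setOf_forall_le b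
  refine ⟨f '' {x | ∀ i, x i ≤ b i}, Set.image_subset_range _ _, hK.image hf, ?_⟩
  -- Continuity from above does need measurable sets, hence the closures; `hsub` shows that their
  -- intersection adds nothing to the compact image.
  have hanti : Antitone fun k => closure (f '' N b k) := fun k l h =>
    closure_mono (Set.image_mono fun x hx i hi => hx i (hi.trans_le h))
  have hsub : ⋂ k, closure (f '' N b k) ⊆ f '' {x | ∀ i, x i ≤ b i} := by
    intro y hy
    by_contra hyK
    obtain ⟨U, V, hU, hV, hKU, hyV, hUV⟩ :=
      (hK.image hf).separation_of_notMem hyK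
    obtain ⟨k, hk⟩ := exists_finite_box_subset (hU.preimage hf) b (Set.image_subset_iff.1 hKU)
    have hcl : y ∈ closure (f '' N b k) := Set.mem_iInter.1 hy k
    obtain ⟨z, hzV, hz⟩ := mem_closure_iff.1 hcl V hV hyV
    exact Set.disjoint_left.1 hUV (Set.image_subset_iff.2 hk hz) hzV
  refine le_trans ?_ (measure_mono hsub)
  rw [hanti.measure_iInter (fun k => isClosed_closure.measurableSet.nullMeasurableSet)
    ⟨0, measure_ne_top _ _⟩]
  refine le_iInf fun k => (hBc k).le.trans ?_
  rw [hBN k]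
  exact measure_mono subset_closure

/-- Analytic sets are universally measurable. -/
theorem MeasureTheory.AnalyticSet.nullMeasurableSet {X : Type*} [TopologicalSpace X] [T2Space X]
    [MeasurableSpace X] [OpensMeasurableSpace X] {s : Set X} (hs : AnalyticSet s)
    (μ : Measure X) [IsFiniteMeasure μ] : NullMeasurableSet s μ := by
  rw [AnalyticSet] at hs
  rcases hs with rfl | ⟨f, hf, rfl⟩
  · exact nullMeasurableSet_empty
  rcases eq_or_ne (μ (Set.range f)) 0 with h0 | h0
  · exact NullMeasurableSet.of_null h0
  obtain ⟨u, -, hu, hulim⟩ := exists_seq_strictMono_tendsto' (pos_iff_ne_zero.2 h0)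
  choose K hKs hK hKu using fun n => exists_isCompact_subset_range_le_measure μ hf (hu n).2
  have hBm : MeasurableSet (⋃ n, K n) := MeasurableSet.iUnion fun n => (hK n).measurableSet
  have hle : μ (Set.range f) ≤ μ (⋃ n, K n) :=
    le_of_tendsto' hulim fun n => (hKu n).trans (measure_mono (Set.subset_iUnion K n))
  exact (hBm.nullMeasurableSet).congr
    (ae_eq_of_subset_of_measure_ge (Set.iUnion_subset hKs) hle hBm.nullMeasurableSet
      (measure_ne_top _ _))

/-! ### Measurable projection and measurable selection. -/

/-- Measurable sets of a product depend on the first coordinate only through countably many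
measurable sets. -/
theorem MeasurableSet.exists_preimage_prodMap_nat_bool {X Y : Type*} [MeasurableSpace X]
    [MeasurableSpace Y] {E : Set (X × Y)} (hE : MeasurableSet E) :
    ∃ f : X → ℕ → Bool, Measurable f ∧ ∃ E' : Set ((ℕ → Bool) × Y), MeasurableSet E' ∧
      E = Prod.map f id ⁻¹' E' := by
  rw [← generateFrom_prod] at hE
  induction E, hE using MeasurableSpace.generateFrom_induction with
  | hC s hs _ =>
    obtain ⟨a, ha, b, hb, rfl⟩ := hs
    classical
    have ha : MeasurableSet a := ha
    have hb : MeasurableSet b := hb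
    refine ⟨fun x _ => decide (x ∈ a), ?_, {z | z 0 = true} ×ˢ b, ?_, ?_⟩
    · refine measurable_pi_lambda _ fun _ => ?_
      exact measurable_to_bool (by simpa [Set.preimage] using ha)
    · exact (measurableSet_eq_fun (measurable_pi_apply 0) measurable_const).prod hb
    · ext p
      simp
  | empty => exact ⟨fun _ _ => true, measurable_const, ∅, MeasurableSet.empty, by simp⟩
  | compl s _ ih =>
    obtain ⟨f, hf, E', hE', rfl⟩ := ih
    exact ⟨f, hf, E'ᶜ, hE'.compl, rfl⟩
  | iUnion s _ ih =>
    choose f hf E' hE' hs using ih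
    have hm : ∀ n : ℕ, Measurable
        (Prod.map (fun (z : ℕ → Bool) k => z (Nat.pair n k)) id :
          (ℕ → Bool) × Y → (ℕ → Bool) × Y) := fun n =>
      (measurable_pi_lambda _ fun k => measurable_pi_apply _).prodMap measurable_id
    -- Countably many codes are interleaved into one sequence through the pairing `ℕ × ℕ ≃ ℕ`.
    refine ⟨fun x k => f k.unpair.1 x k.unpair.2, ?_,
      ⋃ n, Prod.map (fun (z : ℕ → Bool) k => z (Nat.pair n k)) id ⁻¹' E' n,
      MeasurableSet.iUnion fun n => hm n (hE' n), ?_⟩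
    · exact measurable_pi_lambda _ fun k => (measurable_pi_apply _).comp (hf _)
    · rw [Set.preimage_iUnion]
      refine Set.iUnion_congr fun n => ?_
      conv_lhs => rw [hs n]
      ext p
      simp [Prod.map]

/-- The measurable projection theorem. -/
theorem UniversallyComplete.measurableSet_image_fst {X Y : Type*} [MeasurableSpace X]
    (hX : UniversallyComplete X) [TopologicalSpace Y] [PolishSpace Y] [MeasurableSpace Y]
    [BorelSpace Y] {E : Set (X × Y)} (hE : MeasurableSet E) :
    MeasurableSet (Prod.fst '' E) := by
  obtain ⟨f, hf, E', hE', rfl⟩ := hE.exists_preimage_prodMap_nat_bool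
  refine hX _ fun μ hμ => ?_
  have hfst : Prod.fst '' (Prod.map f id ⁻¹' E') = f ⁻¹' (Prod.fst '' E') := by
    ext x
    simp
  rw [hfst]
  have : PolishSpace (ℕ → Bool) :=
    let := TopologicalSpace.metrizableSpaceMetric (ℕ → Bool)
    inferInstance
  -- `X` has no topology, so the analytic set lives in Cantor space and is tested against the
  -- pushforward of `μ`.
  have := (hE'.analyticSet.image_of_continuous continuous_fst).nullMeasurableSet (μ.map f)
  exact this.preimage (hf.quasiMeasurePreserving μ)

/-- A real function on a product, upper semicontinuous in the second variable, which runs over a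
compact space, has a measurable selection of maximizers. -/
theorem UniversallyComplete.exists_measurable_isMax {X Y : Type*} [MeasurableSpace X]
    (hX : UniversallyComplete X) [TopologicalSpace Y] [CompactSpace Y]
    [TopologicalSpace.MetrizableSpace Y] [MeasurableSpace Y] [BorelSpace Y] [Nonempty Y]
    {φ : X → Y → ℝ} (hφ : Measurable (Function.uncurry φ))
    (husc : ∀ x, UpperSemicontinuous (φ x)) :
    ∃ g : X → Y, Measurable g ∧ ∀ x y, φ x y ≤ φ x (g x) := by
  let : MetricSpace Y := TopologicalSpace.metrizableSpaceMetric Y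
  have hmax : ∀ x, ∃ y, ∀ y', φ x y' ≤ φ x y := fun x => by
    obtain ⟨y, -, hy⟩ := UpperSemicontinuousOn.exists_isMaxOn Set.univ_nonempty isCompact_univ
      ((husc x).upperSemicontinuousOn _)
    exact ⟨y, fun y' => hy (Set.mem_univ y')⟩
  choose y₀ hy₀ using hmax
  -- The choice `y₀` need not be measurable, but the maximal value is: its strict superlevel sets
  -- are projections.
  have hm : Measurable fun x => φ x (y₀ x) := by
    refine measurable_of_Ioi fun c => ?_
    convert hX.measurableSet_image_fst (hφ (measurableSet_Ioi (a := c))) using 1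
    ext x
    simp only [Set.mem_preimage, Set.mem_Ioi, Set.mem_image, Prod.exists, exists_and_right,
      exists_eq_right, Function.uncurry]
    exact ⟨fun h => ⟨_, h⟩, fun ⟨y, h⟩ => h.trans_le (hy₀ x y)⟩
  -- Parametrizing `Y` by the Cantor set brings in the order of `ℝ`: the closed set of maximizing
  -- parameters has a least element, a canonical choice whose sublevel sets are again projections.
  obtain ⟨h₀, hh₀, hsurj₀⟩ := exists_nat_bool_continuous_surjective_of_compact Y
  let h : cantorSet → Y := h₀ ∘ cantorSetHomeomorphNatToBool
  have hh : Continuous h := hh₀.comp cantorSetHomeomorphNatToBool.continuous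
  have hsurj : Function.Surjective h := hsurj₀.comp cantorSetHomeomorphNatToBool.surjective
  have : CompactSpace cantorSet := isCompact_iff_compactSpace.1 isCompact_cantorSet
  have hmin : ∀ x, ∃ k : cantorSet, IsLeast {k | φ x (y₀ x) ≤ φ x (h k)} k := by
    intro x
    refine IsCompact.exists_isLeast (IsClosed.isCompact ?_) ?_
    · exact ((husc x).isClosed_preimage (φ x (y₀ x))).preimage hh
    · obtain ⟨k, hk⟩ := hsurj (y₀ x)
      exact ⟨k, by simp [hk]⟩
  choose k hk using hmin
  have hkm : Measurable k := by
    refine Measurable.subtype_mk (f := fun x => (k x : ℝ)) ?_ (h := fun x => (k x).2)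
    refine measurable_of_Iic fun c => ?_
    have hE : MeasurableSet {p : X × cantorSet | (p.2 : ℝ) ≤ c ∧
        φ p.1 (y₀ p.1) ≤ φ p.1 (h p.2)} := by
      refine MeasurableSet.inter ?_ ?_
      · exact measurableSet_le (measurable_subtype_coe.comp measurable_snd) measurable_const
      · exact measurableSet_le (hm.comp measurable_fst)
          (hφ.comp (measurable_fst.prodMk (hh.measurable.comp measurable_snd)))
    convert hX.measurableSet_image_fst hE using 1
    ext x
    simp only [Set.mem_preimage, Set.mem_Iic, Set.mem_image, Set.mem_ofPred_eq, Prod.exists,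
      exists_and_right, exists_eq_right]
    exact ⟨fun h => ⟨k x, h, (hk x).1⟩, fun ⟨k', h1, h2⟩ =>
      le_trans (Subtype.coe_le_coe.2 ((hk x).2 h2)) h1⟩
  exact ⟨fun x => h (k x), hh.measurable.comp hkm, fun x y => (hy₀ x y).trans (hk x).1⟩

/-! ### Semicontinuity of integrals and product measures. -/

theorem MeasureTheory.abs_integral_le_of_forall_abs_le {Ω : Type*} [MeasurableSpace Ω]
    {μ : Measure Ω} [IsProbabilityMeasure μ] {f : Ω → ℝ} {c : ℝ} (hf : ∀ ω, |f ω| ≤ c) :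
    |∫ ω, f ω ∂μ| ≤ c := by
  simpa using norm_integral_le_of_norm_le_const (μ := μ) (f := f) (C := c) (.of_forall hf)

/-- Fatou's lemma for the nonnegative functions `c - f x`; first countability permits it along
neighbourhood filters. -/
theorem UpperSemicontinuous.integral_of_abs_le {X Ω : Type*} [TopologicalSpace X]
    [FirstCountableTopology X] [MeasurableSpace Ω] (μ : Measure Ω) [IsFiniteMeasure μ]
    {f : X → Ω → ℝ} {c : ℝ} (hm : ∀ x, Measurable (f x)) (hb : ∀ x ω, |f x ω| ≤ c)
    (hf : ∀ ω, UpperSemicontinuous fun x => f x ω) :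
    UpperSemicontinuous fun x => ∫ ω, f x ω ∂μ := by
  have hlsc : LowerSemicontinuous fun x => ∫⁻ ω, ENNReal.ofReal (c - f x ω) ∂μ := by
    have hpt : ∀ ω, LowerSemicontinuous fun x => ENNReal.ofReal (c - f x ω) := fun ω =>
      (ENNReal.continuous_ofReal.comp (continuous_const.sub continuous_id)
        : Continuous fun r : ℝ => ENNReal.ofReal (c - r)).comp_upperSemicontinuous_antitone (hf ω)
        fun r s h => ENNReal.ofReal_le_ofReal (sub_le_sub_left h c)
    rw [lowerSemicontinuous_iff_le_liminf]
    intro x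
    exact (lintegral_mono fun ω => lowerSemicontinuous_iff_le_liminf.1 (hpt ω) x).trans
      (lintegral_liminf_le fun x => (measurable_const.sub (hm x)).ennreal_ofReal)
  have hint : ∀ x, Integrable (f x) μ := fun x =>
    .of_bound (hm x).aestronglyMeasurable c (.of_forall (hb x))
  have hI : ∀ x, 0 ≤ ∫ ω, (c - f x ω) ∂μ := fun x =>
    integral_nonneg fun ω => sub_nonneg.2 (abs_le.1 (hb x ω)).2
  have heq : ∀ x, ∫⁻ ω, ENNReal.ofReal (c - f x ω) ∂μ = ENNReal.ofReal (∫ ω, (c - f x ω) ∂μ) :=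
    fun x => (ofReal_integral_eq_lintegral_ofReal ((integrable_const c).sub (hint x))
      (.of_forall fun ω => sub_nonneg.2 (abs_le.1 (hb x ω)).2)).symm
  have hsub : ∀ x, ∫ ω, (c - f x ω) ∂μ = ∫ _, c ∂μ - ∫ ω, f x ω ∂μ := fun x =>
    integral_sub (integrable_const c) (hint x)
  intro x y hy
  -- `ENNReal.ofReal` forgets negative values, but in that case `y` already exceeds every integral.
  rcases lt_or_ge (∫ _, c ∂μ - y) 0 with hz | hz
  · refine .of_forall fun x' => ?_
    have := hI x'
    rw [hsub] at this
    change ∫ ω, f x' ω ∂μ < y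
    linarith
  · have h1 : ENNReal.ofReal (∫ _, c ∂μ - y) < ∫⁻ ω, ENNReal.ofReal (c - f x ω) ∂μ := by
      rw [heq, hsub, ENNReal.ofReal_lt_ofReal_iff_of_nonneg hz]
      change ∫ ω, f x ω ∂μ < y at hy
      linarith
    filter_upwards [hlsc x _ h1] with x' hx'
    rw [heq, hsub, gt_iff_lt, ENNReal.ofReal_lt_ofReal_iff_of_nonneg hz] at hx'
    linarith

/-- Resampling the `i`-th coordinate of a product measure. -/
theorem MeasureTheory.Measure.map_update_prod_pi {ι : Type*} [Fintype ι] [DecidableEq ι]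
    {A : ι → Type*} [∀ i, MeasurableSpace (A i)] (μ : ∀ i, Measure (A i))
    [∀ i, IsProbabilityMeasure (μ i)] (i : ι) (ν : Measure (A i)) [IsProbabilityMeasure ν] :
    ((Measure.pi μ).prod ν).map (fun p => Function.update p.1 i p.2) =
      Measure.pi (Function.update μ i ν) := by
  have hprob : ∀ j, IsProbabilityMeasure (Function.update μ i ν j) := by
    intro j
    rcases eq_or_ne j i with rfl | h
    · rwa [Function.update_self]
    · rw [Function.update_of_ne h]
      infer_instance
  symm
  refine Measure.pi_eq fun s hs => ?_
  rw [Measure.map_apply (by fun_prop) (MeasurableSet.univ_pi hs)]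
  have : (fun p : (∀ j, A j) × A i => Function.update p.1 i p.2) ⁻¹' Set.univ.pi s =
      (Set.univ.pi (Function.update s i Set.univ)) ×ˢ s i := by
    ext p
    simp only [Set.mem_preimage, Set.mem_univ_pi, Set.mem_prod]
    constructor
    · refine fun h => ⟨fun j => ?_, by simpa using h i⟩
      rcases eq_or_ne j i with rfl | hj
      · simp
      · simpa [hj] using h j
    · rintro ⟨h, h'⟩ j
      rcases eq_or_ne j i with rfl | hj
      · simpa
      · simpa [hj] using h j
  rw [this, Measure.prod_prod, Measure.pi_pi,
    ← Finset.mul_prod_erase _ _ (Finset.mem_univ i),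
    ← Finset.mul_prod_erase (a := i) _ (fun j => (Function.update μ i ν j) (s j))
      (Finset.mem_univ i)]
  simp only [Function.update_self, measure_univ, one_mul]
  rw [mul_comm]
  congr 1
  refine Finset.prod_congr rfl fun j hj => ?_
  simp [Finset.ne_of_mem_erase hj]

theorem MeasureTheory.integral_pi_update {ι : Type*} [Fintype ι] [DecidableEq ι]
    {A : ι → Type*} [∀ i, MeasurableSpace (A i)] (μ : ∀ i, Measure (A i))
    [∀ i, IsProbabilityMeasure (μ i)] (i : ι) (ν : Measure (A i)) [IsProbabilityMeasure ν]
    {f : (∀ j, A j) → ℝ} (hf : Measurable f) {c : ℝ} (hc : ∀ a, |f a| ≤ c) :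
    ∫ a, f a ∂(Measure.pi (Function.update μ i ν)) =
      ∫ a, ∫ b, f (Function.update b i a) ∂(Measure.pi μ) ∂ν := by
  have hu : Measurable fun p : (∀ j, A j) × A i => Function.update p.1 i p.2 := by fun_prop
  rw [← Measure.map_update_prod_pi, integral_map hu.aemeasurable hf.aestronglyMeasurable]
  exact integral_prod_symm _ (.of_bound (hf.comp hu).aestronglyMeasurable c
    (.of_forall fun p => hc _))

theorem Equiv.piSplitAt_symm_self {ι : Type*} [DecidableEq ι] {T : ι → Type*} (i : ι) (ti : T i)
    (q : ∀ j : {j // j ≠ i}, T j) :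
    (Equiv.piSplitAt i T).symm (ti, q) i = ti := by
  simp [Equiv.piSplitAt]

theorem Equiv.piSplitAt_symm_of_ne {ι : Type*} [DecidableEq ι] {T : ι → Type*} (i : ι) (ti : T i)
    (q : ∀ j : {j // j ≠ i}, T j) {j : ι} (h : j ≠ i) :
    (Equiv.piSplitAt i T).symm (ti, q) j = q ⟨j, h⟩ := by
  simp [Equiv.piSplitAt, h]

theorem Equiv.measurable_piSplitAt_symm {ι : Type*} [DecidableEq ι] {T : ι → Type*}
    [∀ i, MeasurableSpace (T i)] (i : ι) :
    Measurable fun p : T i × (∀ j : {j // j ≠ i}, T j) => (Equiv.piSplitAt i T).symm p := by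
  refine measurable_pi_lambda _ fun j => ?_
  by_cases h : j = i
  · subst h
    simpa [Equiv.piSplitAt] using measurable_fst
  · have : Measurable fun p : T i × (∀ j : {j // j ≠ i}, T j) => p.2 ⟨j, h⟩ := by fun_prop
    simpa [Equiv.piSplitAt, h] using this

/-! ### Strategies as kernels, and payoffs from single actions. -/

namespace BehavioralStrategy

instance {X Y : Type*} [MeasurableSpace X] [MeasurableSpace Y] (γ : BehavioralStrategy X Y) :
    IsMarkovKernel γ.1 := γ.2

variable {ι : Type*} [Fintype ι] {T : ι → Type*} {A : ι → Type*}
  [∀ i, MeasurableSpace (T i)] [∀ i, MeasurableSpace (A i)]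

/-- The joint law of the independently drawn actions, as a kernel from type profiles to action
profiles. -/
noncomputable def piKernel (γ : ∀ j, BehavioralStrategy (T j) (A j)) :
    Kernel (∀ j, T j) (∀ j, A j) where
  toFun t := Measure.pi fun j => (γ j).1 (t j)
  measurable' := by
    refine Measurable.measure_of_isPiSystem_of_isProbabilityMeasure generateFrom_pi.symm
      isPiSystem_pi ?_
    rintro _ ⟨s, hs, rfl⟩
    simp only [Measure.pi_pi]
    exact Finset.measurable_prod _ fun j _ =>
      ((γ j).1.measurable_coe (hs j (Set.mem_univ j))).comp (measurable_pi_apply j)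

theorem piKernel_apply (γ : ∀ j, BehavioralStrategy (T j) (A j)) (t : ∀ j, T j) :
    piKernel γ t = Measure.pi fun j => (γ j).1 (t j) := rfl

instance (γ : ∀ j, BehavioralStrategy (T j) (A j)) : IsMarkovKernel (piKernel γ) :=
  ⟨fun t => by rw [piKernel_apply]; infer_instance⟩

/-- The strategy that plays the action `g t` for the types `t ∈ N`, and as `γ` otherwise. -/
noncomputable def modify {X Y : Type*} [MeasurableSpace X] [MeasurableSpace Y]
    (γ : BehavioralStrategy X Y) {N : Set X} (hN : MeasurableSet N) [DecidablePred (· ∈ N)]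
    {g : X → Y} (hg : Measurable g) : BehavioralStrategy X Y :=
  ⟨Kernel.piecewise hN (Kernel.deterministic g hg) γ.1, inferInstance⟩

theorem modify_apply {X Y : Type*} [MeasurableSpace X] [MeasurableSpace Y]
    (γ : BehavioralStrategy X Y) {N : Set X} (hN : MeasurableSet N) [DecidablePred (· ∈ N)]
    {g : X → Y} (hg : Measurable g) (x : X) :
    (γ.modify hN hg).1 x = if x ∈ N then Measure.dirac (g x) else γ.1 x := by
  simp only [modify, Kernel.piecewise_apply, Kernel.deterministic_apply]

end BehavioralStrategy

namespace IncompleteInfoGame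

variable {ι : Type*} [Fintype ι] [DecidableEq ι] {S : Type*} {T : ι → Type*} {A : ι → Type*}
  [MeasurableSpace S] [∀ i, MeasurableSpace (T i)] [∀ i, MeasurableSpace (A i)]

instance (G : IncompleteInfoGame ι S T A) (i : ι) : IsMarkovKernel (G.belief i) :=
  G.isMarkovKernel_belief i

/-- The expected payoff of player `i` from the action `a`, the others playing `γ`. -/
noncomputable def actionPayoff (G : IncompleteInfoGame ι S T A) (i : ι)
    (γ : ∀ j, BehavioralStrategy (T j) (A j)) (ti : T i) (a : A i) : ℝ :=
  ∫ p, ∫ b, G.payoff i (Function.update b i a) p.1 ((Equiv.piSplitAt i T).symm (ti, p.2))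
    ∂(BehavioralStrategy.piKernel γ ((Equiv.piSplitAt i T).symm (ti, p.2))) ∂(G.belief i ti)

variable (G : IncompleteInfoGame ι S T A) (i : ι) (γ : ∀ j, BehavioralStrategy (T j) (A j))

/-- The draw `b` includes an action of player `i`, which the update overwrites; the full product
kernel thus serves without splitting off index `i`. -/
theorem measurable_integral_payoff_update :
    Measurable fun z : (T i × A i) × (S × (∀ j : {j // j ≠ i}, T j)) =>
      ∫ b, G.payoff i (Function.update b i z.1.2) z.2.1
          ((Equiv.piSplitAt i T).symm (z.1.1, z.2.2))
        ∂(BehavioralStrategy.piKernel γ ((Equiv.piSplitAt i T).symm (z.1.1, z.2.2))) := by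
  have ht : Measurable fun z : (T i × A i) × (S × (∀ j : {j // j ≠ i}, T j)) =>
      (Equiv.piSplitAt i T).symm (z.1.1, z.2.2) :=
    (Equiv.measurable_piSplitAt_symm i).comp (by fun_prop)
  have hu : Measurable fun p : A i × (∀ j, A j) => Function.update p.2 i p.1 := by fun_prop
  have hF : Measurable fun w : ((T i × A i) × (S × (∀ j : {j // j ≠ i}, T j))) × (∀ j, A j) =>
      G.payoff i (Function.update w.2 i w.1.1.2) w.1.2.1
        ((Equiv.piSplitAt i T).symm (w.1.1.1, w.1.2.2)) :=
    (G.measurable_payoff i).comp ((hu.comp (by fun_prop : Measurable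
      fun w : ((T i × A i) × (S × (∀ j : {j // j ≠ i}, T j))) × (∀ j, A j) =>
        (w.1.1.2, w.2))).prodMk ((by fun_prop : Measurable
      fun w : ((T i × A i) × (S × (∀ j : {j // j ≠ i}, T j))) × (∀ j, A j) =>
        w.1.2.1).prodMk (ht.comp measurable_fst)))
  exact (hF.stronglyMeasurable.integral_kernel_prod_right'
    (κ := (BehavioralStrategy.piKernel γ).comap _ ht)).measurable

theorem measurable_actionPayoff :
    Measurable (Function.uncurry (G.actionPayoff i γ)) :=
  ((G.measurable_integral_payoff_update i γ).stronglyMeasurable.integral_kernel_prod_right'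
    (κ := (G.belief i).comap Prod.fst measurable_fst)).measurable

variable {G} {ubar : ∀ i, T i → ℝ≥0}

theorem IsPayoffBound.abs_integral_payoff_update_le (hubar : G.IsPayoffBound ubar) (ti : T i)
    (a : A i) (p : S × (∀ j : {j // j ≠ i}, T j)) :
    |∫ b, G.payoff i (Function.update b i a) p.1 ((Equiv.piSplitAt i T).symm (ti, p.2))
      ∂(BehavioralStrategy.piKernel γ ((Equiv.piSplitAt i T).symm (ti, p.2)))| ≤ ubar i ti := by
  refine abs_integral_le_of_forall_abs_le fun b => ?_
  simpa [Equiv.piSplitAt_symm_self] using hubar.2 i (Function.update b i a) p.1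
    ((Equiv.piSplitAt i T).symm (ti, p.2))

theorem IsPayoffBound.abs_actionPayoff_le (hubar : G.IsPayoffBound ubar) (ti : T i) (a : A i) :
    |G.actionPayoff i γ ti a| ≤ ubar i ti :=
  abs_integral_le_of_forall_abs_le (hubar.abs_integral_payoff_update_le i γ ti a)

theorem IsPayoffBound.upperSemicontinuous_actionPayoff [∀ i, TopologicalSpace (A i)]
    [FirstCountableTopology (A i)] (hubar : G.IsPayoffBound ubar)
    (husc : G.UpperSemicontinuousInOwnAction) (ti : T i) :
    UpperSemicontinuous (G.actionPayoff i γ ti) := by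
  refine UpperSemicontinuous.integral_of_abs_le _ (c := ubar i ti) (fun a => ?_) (fun a p =>
    hubar.abs_integral_payoff_update_le i γ ti a p) fun p => ?_
  · exact (G.measurable_integral_payoff_update i γ).comp
      (measurable_const (a := (ti, a)) |>.prodMk measurable_id)
  · refine UpperSemicontinuous.integral_of_abs_le _ (c := ubar i ti) (fun a => ?_) (fun a b => ?_)
      fun b => husc i b _ _
    · exact (G.measurable_payoff i).comp ((by fun_prop : Measurable
        fun b : ∀ j, A j => Function.update b i a).prodMk (measurable_const (a := (p.1, _))))
    · simpa [Equiv.piSplitAt_symm_self] using hubar.2 i (Function.update b i a) p.1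
        ((Equiv.piSplitAt i T).symm (ti, p.2))

/-- Linearity in the player's own mixed action, by resampling coordinate `i` and Fubini. It reduces
best responses to maximizing over pure actions, type by type. -/
theorem IsPayoffBound.expectedPayoff_update (hubar : G.IsPayoffBound ubar)
    (γi : BehavioralStrategy (T i) (A i)) (ti : T i) :
    G.expectedPayoff i (Function.update γ i γi) ti =
      ∫ a, G.actionPayoff i γ ti a ∂(γi.1 ti) := by
  have hst : ∀ p : S × (∀ j : {j // j ≠ i}, T j),
      G.stateTypePayoff i (Function.update γ i γi) p.1 ((Equiv.piSplitAt i T).symm (ti, p.2)) =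
        ∫ a, ∫ b, G.payoff i (Function.update b i a) p.1 ((Equiv.piSplitAt i T).symm (ti, p.2))
          ∂(BehavioralStrategy.piKernel γ ((Equiv.piSplitAt i T).symm (ti, p.2)))
          ∂(γi.1 ti) := by
    intro p
    set t := (Equiv.piSplitAt i T).symm (ti, p.2) with ht
    have hti : t i = ti := Equiv.piSplitAt_symm_self i ti p.2
    have hupd : (fun j => (Function.update γ i γi j).1 (t j)) =
        Function.update (fun j => (γ j).1 (t j)) i (γi.1 ti) := by
      funext j
      rcases eq_or_ne j i with rfl | hj
      · simp [hti]
      · simp [hj]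
    rw [stateTypePayoff, hupd]
    refine integral_pi_update _ i _ ?_ (c := ubar i ti) fun a => ?_
    · exact (G.measurable_payoff i).comp (measurable_id.prodMk (measurable_const (a := (p.1, t))))
    · simpa [hti] using hubar.2 i a p.1 t
  simp only [expectedPayoff, hst, actionPayoff]
  refine integral_integral_swap (.of_bound (C := ubar i ti) ?_ (.of_forall fun z =>
    hubar.abs_integral_payoff_update_le i γ ti z.2 z.1))
  exact ((G.measurable_integral_payoff_update i γ).comp
    ((measurable_const (a := ti) |>.prodMk measurable_snd).prodMk
      measurable_fst)).aestronglyMeasurable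

theorem IsPayoffBound.expectedPayoff_eq (hubar : G.IsPayoffBound ubar) (ti : T i) :
    G.expectedPayoff i γ ti = ∫ a, G.actionPayoff i γ ti a ∂((γ i).1 ti) := by
  simpa using hubar.expectedPayoff_update i γ (γ i) ti

theorem IsPayoffBound.integrable_actionPayoff (hubar : G.IsPayoffBound ubar) (ti : T i)
    (μ : Measure (A i)) [IsFiniteMeasure μ] : Integrable (G.actionPayoff i γ ti) μ :=
  .of_bound ((G.measurable_actionPayoff i γ).of_uncurry_left).aestronglyMeasurable (ubar i ti)
    (.of_forall fun a => hubar.abs_actionPayoff_le i γ ti a)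

theorem IsPayoffBound.measurable_expectedPayoff (hubar : G.IsPayoffBound ubar) :
    Measurable (G.expectedPayoff i γ) := by
  rw [funext (hubar.expectedPayoff_eq i γ)]
  exact ((G.measurable_actionPayoff i γ).stronglyMeasurable.integral_kernel_prod_right'
    (κ := (γ i).1)).measurable

theorem IsPayoffBound.integrable_expectedPayoff (hubar : G.IsPayoffBound ubar)
    {ν : ProductProbability S T} (hν : ν ∈ G.dominatingMeasures ubar) :
    Integrable (G.expectedPayoff i γ) (ν.type i : Measure (T i)) := by
  refine Integrable.mono' (g := fun ti => (ubar i ti : ℝ)) ?_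
    (hubar.measurable_expectedPayoff i γ).aestronglyMeasurable (.of_forall fun ti => ?_)
  · refine ⟨(hubar.1 i).coe_nnreal_real.aestronglyMeasurable, ?_⟩
    simpa [HasFiniteIntegral, enorm] using hν.2 i
  · rw [hubar.expectedPayoff_eq]
    exact abs_integral_le_of_forall_abs_le (hubar.abs_actionPayoff_le i γ ti)

/-! ### From Nash to Bayesian equilibria. -/

/-- The expected payoff of each type depends on the strategies of the other players only up to
null sets. -/
theorem expectedPayoff_update_congr {ν : ProductProbability S T}
    (hν : ν ∈ G.dominatingMeasures ubar) {γ γ' : ∀ j, BehavioralStrategy (T j) (A j)}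
    (h : ∀ j, ∀ᵐ tj ∂(ν.type j : Measure (T j)), (γ j).1 tj = (γ' j).1 tj)
    (γi : BehavioralStrategy (T i) (A i)) (ti : T i) :
    G.expectedPayoff i (Function.update γ i γi) ti =
      G.expectedPayoff i (Function.update γ' i γi) ti := by
  have hpi : ∀ᵐ p ∂(ν.others i), ∀ j : {j // j ≠ i}, (γ j).1 (p.2 j) = (γ' j).1 (p.2 j) := by
    refine Measure.quasiMeasurePreserving_snd.ae
      (p := fun q : ∀ j : {j // j ≠ i}, T j => ∀ j : {j // j ≠ i}, (γ j).1 (q j) = (γ' j).1 (q j)) ?_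
    rw [ae_all_iff]
    intro j
    exact (Measure.quasiMeasurePreserving_eval
      (fun j : {j // j ≠ i} => (ν.type j : Measure (T j))) j).ae (h j)
  refine integral_congr_ae ?_
  filter_upwards [(hν.1 i ti).ae_le hpi] with p hp
  rw [stateTypePayoff, stateTypePayoff]
  congr 2
  funext j
  rcases eq_or_ne j i with rfl | hj
  · simp
  · simpa [hj, Equiv.piSplitAt_symm_of_ne i ti p.2 hj] using hp ⟨j, hj⟩

theorem bayesianEquilibria_subset_nashEquilibria (hubar : G.IsPayoffBound ubar)
    {ν : ProductProbability S T} (hν : ν ∈ G.dominatingMeasures ubar) :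
    G.bayesianEquilibria ⊆ G.nashEquilibria ν := fun _ hγ i γi =>
  integral_mono (hubar.integrable_expectedPayoff i _ hν) (hubar.integrable_expectedPayoff i _ hν)
    fun ti => hγ i ti γi

theorem exists_bayesianEquilibrium_of_mem_nashEquilibria
    [∀ i, TopologicalSpace (A i)] [∀ i, CompactSpace (A i)]
    [∀ i, TopologicalSpace.MetrizableSpace (A i)] [∀ i, BorelSpace (A i)]
    (hT : ∀ i, UniversallyComplete (T i)) (hubar : G.IsPayoffBound ubar)
    (husc : G.UpperSemicontinuousInOwnAction)
    {ν : ProductProbability S T} (hν : ν ∈ G.dominatingMeasures ubar)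
    {γ' : ∀ j, BehavioralStrategy (T j) (A j)} (hγ' : γ' ∈ G.nashEquilibria ν) :
    ∃ γ ∈ G.bayesianEquilibria,
      ∀ i, ∀ᵐ ti ∂(ν.type i : Measure (T i)), (γ i).1 ti = (γ' i).1 ti := by
  classical
  -- Probability measures live only on nonempty spaces: `ν.type i` supplies a type, and the strategy
  -- at that type supplies an action.
  have hA : ∀ i, Nonempty (A i) := fun i => by
    obtain ⟨ti⟩ := (ν.type i : Measure (T i)).nonempty_of_neZero
    exact ((γ' i).1 ti).nonempty_of_neZero
  choose g hg hgmax using fun i => (hT i).exists_measurable_isMax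
    (G.measurable_actionPayoff i γ') (hubar.upperSemicontinuous_actionPayoff i γ' husc)
  have hmeas : ∀ i, Measurable fun ti => G.actionPayoff i γ' ti (g i ti) := fun i =>
    (G.measurable_actionPayoff i γ').comp (measurable_id.prodMk (hg i))
  have hle : ∀ i ti (μ : Measure (A i)) [IsProbabilityMeasure μ],
      ∫ a, G.actionPayoff i γ' ti a ∂μ ≤ G.actionPayoff i γ' ti (g i ti) := by
    intro i ti μ _
    refine (integral_mono (hubar.integrable_actionPayoff i γ' ti μ) (integrable_const _)
      (hgmax i ti)).trans_eq ?_
    simp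
  have hN : ∀ i, MeasurableSet
      {ti | G.expectedPayoff i γ' ti < G.actionPayoff i γ' ti (g i ti)} := fun i =>
    measurableSet_lt (hubar.measurable_expectedPayoff i γ') (hmeas i)
  let γ : ∀ j, BehavioralStrategy (T j) (A j) := fun i => (γ' i).modify (hN i) (hg i)
  have hopt : ∀ i ti, G.expectedPayoff i (Function.update γ' i (γ i)) ti =
      G.actionPayoff i γ' ti (g i ti) := by
    intro i ti
    rw [hubar.expectedPayoff_update, BehavioralStrategy.modify_apply]
    split_ifs with h
    · exact integral_dirac _ _
    · refine le_antisymm (hle i ti _) ?_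
      rw [← hubar.expectedPayoff_eq]
      exact not_lt.1 h
  have hae : ∀ i, ∀ᵐ ti ∂(ν.type i : Measure (T i)), (γ i).1 ti = (γ' i).1 ti := by
    intro i
    have hint := hubar.integrable_expectedPayoff i γ' hν
    have hint' := hubar.integrable_expectedPayoff i (Function.update γ' i (γ i)) hν
    have hmono : G.expectedPayoff i γ' ≤ G.expectedPayoff i (Function.update γ' i (γ i)) := by
      intro ti
      rw [hopt, hubar.expectedPayoff_eq]
      exact hle i ti _
    -- The deviation is pointwise no worse, and by the Nash property no better on average, so the
    -- payoffs agree almost everywhere; the modified types, which gain strictly, form a null set.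
    have heq := (integral_eq_iff_of_ae_le hint hint' (.of_forall hmono)).1
      (le_antisymm (integral_mono hint hint' hmono) (hγ' i (γ i)))
    filter_upwards [heq] with ti hti
    rw [BehavioralStrategy.modify_apply, if_neg]
    rw [hopt] at hti
    exact fun h => h.ne hti
  refine ⟨γ, fun i ti γi => ?_, hae⟩
  -- Both sides are moved from opponents `γ` to opponents `γ'`, against whom `γ i` attains the
  -- maximum at every type.
  have h1 := expectedPayoff_update_congr i hν hae γi ti
  have h2 := expectedPayoff_update_congr i hν hae (γ i) ti
  rw [Function.update_eq_self] at h2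
  rw [h1, h2, hopt, hubar.expectedPayoff_update]
  exact hle i ti _

end IncompleteInfoGame

theorem mainTheorem1 {ι : Type*} [Fintype ι] [DecidableEq ι]
    {S : Type*} {T : ι → Type*} {A : ι → Type*}
    [MeasurableSpace S] [∀ i, MeasurableSpace (T i)]
    [∀ i, TopologicalSpace (A i)] [∀ i, CompactSpace (A i)]
    [∀ i, TopologicalSpace.MetrizableSpace (A i)]
    [∀ i, MeasurableSpace (A i)] [∀ i, BorelSpace (A i)]
    (hT : ∀ i, UniversallyComplete (T i))
    (G : IncompleteInfoGame ι S T A)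
    (ubar : ∀ i, T i → ℝ≥0) (hubar : G.IsPayoffBound ubar)
    (husc : G.UpperSemicontinuousInOwnAction)
    (hM : (G.dominatingMeasures ubar).Nonempty) :
    (G.bayesianEquilibria.Nonempty ↔
      ∃ ν ∈ G.dominatingMeasures ubar, (G.nashEquilibria ν).Nonempty) ∧
    ∀ ν ∈ G.dominatingMeasures ubar, ∀ γ' ∈ G.nashEquilibria ν,
      ∃ γ ∈ G.bayesianEquilibria,
        ∀ i, ∀ᵐ ti ∂(ν.type i : Measure (T i)), (γ i).1 ti = (γ' i).1 ti := by
  have hNE : ∀ ν ∈ G.dominatingMeasures ubar, ∀ γ' ∈ G.nashEquilibria ν,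
      ∃ γ ∈ G.bayesianEquilibria,
        ∀ i, ∀ᵐ ti ∂(ν.type i : Measure (T i)), (γ i).1 ti = (γ' i).1 ti := fun ν hν γ' hγ' =>
    IncompleteInfoGame.exists_bayesianEquilibrium_of_mem_nashEquilibria hT hubar husc hν hγ'
  refine ⟨⟨fun hBE => ?_, fun ⟨ν, hν, γ', hγ'⟩ => ?_⟩, hNE⟩
  · obtain ⟨ν, hν⟩ := hM
    exact ⟨ν, hν, hBE.mono
      (IncompleteInfoGame.bayesianEquilibria_subset_nashEquilibria hubar hν)⟩
  · obtain ⟨γ, hγ, -⟩ := hNE ν hν γ' hγ'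
    exact ⟨γ, hγ⟩
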